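/- Let $\Bbbk$ be an algebraically closed field of characteristic $0$, let $\mathcal S=\Bbbk[X_0,\dots,X_n]$ and $\mathcal R=\Bbbk[Y_0,\dots,Y_n]$ with their standard gradings, and let $\mathcal R$ act on $\mathcal S$ by differentiation, $Y^\beta\circ X^\alpha=\frac{\alpha!}{(\alpha-\beta)!}X^{\alpha-\beta}$ if $\alpha\succeq\beta$ and $0$ otherwise. Regard $\mathcal R$ as the coordinate ring of $\mathbb P^n=\mathbb P(\mathcal S_1)$. A $0$-dimensional scheme $Z\subset\mathbb P^n$ with saturated ideal $I(Z)\subseteq\mathcal R$ is *apolar* to $F\in\mathcal S_d$ if $G\circ F=0$ for all $G\in I(Z)$, and *irredundant* to $F$ if it is apolar to $F$ and no strict subscheme of $Z$ is apolar to $F$. Its Hilbert function is $\mathrm{HF}_Z(i)=\dim_\Bbbk \mathcal R_i/I(Z)_i$, which is eventually constant equal to the length $\mathrm{len}(Z)$; its regularity is $\mathrm{reg}(Z)=\min\{i\in\mathbb N:\mathrm{HF}_Z(i)=\mathrm{HF}_Z(i+1)=\mathrm{len}(Z)\}$, and $Z$ is *$d$-regular* if $\mathrm{reg}(Z)\le d$.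 A *generalized additive decomposition* (GAD) of $F\in\mathcal S_d$ is an expression $F=\sum_{i=1}^s L_i^{d-k_i}G_i$ with $L_1,\dots,L_s\in\mathcal S_1$ nonzero and pairwise non-proportional, $0\le k_i\le d$, and $G_i\in\mathcal S_{k_i}$ not divisible by $L_i$. For $F\in\mathcal S_d$ and $0\ne L\in\mathcal S_1$, the *natural apolar scheme* $Z_{F,L}$ is defined as follows. Complete $L=L_0$ to a basis $L_0,\dots,L_n$ of $\mathcal S_1$ and write $F$ in these coordinates in divided powers, $F=\sum_{|\alpha|=d}c_\alpha L_0^{[\alpha_0]}\cdots L_n^{[\alpha_n]}$, where $L_j^{[a]}=L_j^a/a!$. Let $f_L=\sum_{|\alpha|=d}c_\alpha\, x_1^{[\alpha_1]}\cdots x_n^{[\alpha_n]}$, and let $\Bbbk[y_1,\dots,y_n]$ act by contraction: $y^\beta$ sends $x^{[\alpha]}$ to $x^{[\alpha-\beta]}$ if $\alpha\succeq\beta$ and to $0$ otherwise. In the basis of $\mathcal R_1$ dual to $L_0,\dots,L_n$, the ideal $I(Z_{F,L})$ is the homogenization of the annihilator of $f_L$ in $\Bbbk[y_1,\dots,y_n]$;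 the scheme does not depend on the chosen basis. The *scheme evinced by the GAD* $F=\sum_i L_i^{d-k_i}G_i$ is $Z=\bigcup_{i=1}^s Z_{L_i^{d-k_i}G_i,\,L_i}$, that is, $I(Z)=\bigcap_i I(Z_{L_i^{d-k_i}G_i,\,L_i})$. **Proposition.** Let $s>1$, let $L_1,\dots,L_s\in\mathcal S_1$ be $\Bbbk$-linearly independent, and let $Z$ be the scheme evinced by a GAD $F=\sum_{i=1}^s L_i^{d-k_i}G_i$ of $F\in\mathcal S_d$. If either (a) $d>\max_{i\ne j}\{k_i+k_j\}$, or (b) $d>\max_{i\ne j}\{k_i+k_j-2\}$ and $Z$ is irredundant to $F$, then $Z$ is $d$-regular. -/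

import Mathlib

open MvPolynomial

noncomputable section

namespace Apolarity

attribute [local instance] MvPolynomial.gradedAlgebra

/-! ## Differentiation, contraction, divided powers -/

section Actions

variable {k : Type*} [Field k] {σ : Type*} [Fintype σ]

open Classical in
/-- The apolarity action `G ∘ F` of `R = k[Y]` on `S = k[X]` by differentiation: bilinear, with
`Y^β ∘ X^α = α! / (α - β)! X^(α - β)` if `β ≤ α` and `0` otherwise. -/
def diffAction : MvPolynomial σ k →ₗ[k] MvPolynomial σ k →ₗ[k] MvPolynomial σ k :=
  (basisMonomials σ k).constr k fun β =>
    (basisMonomials σ k).constr k fun α =>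
      if β ≤ α then monomial (α - β) ((∏ i, (α i).descFactorial (β i) : ℕ) : k) else 0

/-- The annihilator `Ann(F)` for the apolarity action, as a set. -/
def annSet (F : MvPolynomial σ k) : Set (MvPolynomial σ k) := {G | diffAction G F = 0}

open Classical in
/-- The contraction action of `R` on divided power polynomials. A divided power polynomial
`∑ c_α X^[α]` is stored as the polynomial with coefficients `c_α`; the action is bilinear, with
`Y^β ⌟ X^[α] = X^[α - β]` if `β ≤ α` and `0` otherwise. -/
def contract : MvPolynomial σ k →ₗ[k] MvPolynomial σ k →ₗ[k] MvPolynomial σ k :=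
  (basisMonomials σ k).constr k fun β =>
    (basisMonomials σ k).constr k fun α =>
      if β ≤ α then monomial (α - β) (1 : k) else 0

/-- `F ↦ F_dp`: since `X^α = α! X^[α]`, the coefficient of `X^[α]` in `F_dp` is `α!` times the
coefficient of `X^α` in `F`. -/
def toDividedPowers : MvPolynomial σ k →ₗ[k] MvPolynomial σ k :=
  (basisMonomials σ k).constr k fun α => monomial α ((∏ i, (α i).factorial : ℕ) : k)

end Actions

section Contract

variable {k : Type*} [Field k] {σ : Type*}

open Classical in
theorem contract_monomial (β α : σ →₀ ℕ) (c e : k) :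
    contract (monomial β c) (monomial α e) =
      if β ≤ α then monomial (α - β) (c * e) else 0 := by
  have h1 : monomial β c = c • basisMonomials σ k β := by
    simp [coe_basisMonomials, smul_monomial]
  have h2 : monomial α e = e • basisMonomials σ k α := by
    simp [coe_basisMonomials, smul_monomial]
  have h3 : contract (basisMonomials σ k β) (basisMonomials σ k α) =
      if β ≤ α then monomial (α - β) (1 : k) else 0 := by
    rw [contract, Module.Basis.constr_basis, Module.Basis.constr_basis]
  rw [h1, h2, map_smul, map_smul, LinearMap.smul_apply, h3]
  split_ifs
  · simp [smul_monomial, mul_comm]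
  · simp

theorem contract_mul (g h f : MvPolynomial σ k) :
    contract (g * h) f = contract g (contract h f) := by
  induction g using MvPolynomial.induction_on' with
  | add p q hp hq => simp [add_mul, hp, hq]
  | monomial γ a =>
    induction h using MvPolynomial.induction_on' with
    | add p q hp hq => simp [mul_add, hp, hq]
    | monomial β b =>
      induction f using MvPolynomial.induction_on' with
      | add p q hp hq => rw [map_add, map_add, map_add, hp, hq]
      | monomial α c =>
        rw [monomial_mul, contract_monomial, contract_monomial]
        by_cases h1 : β ≤ α
        · rw [if_pos h1, contract_monomial]
          by_cases h2 : γ ≤ α - β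
          · rw [if_pos h2, if_pos ((le_tsub_iff_right h1).1 h2), tsub_tsub, add_comm β γ, mul_assoc]
          · rw [if_neg h2, if_neg fun h => h2 ((le_tsub_iff_right h1).2 h)]
        · rw [if_neg h1, map_zero, if_neg fun h => h1 (le_trans (by simp) h)]

/-- The annihilator of `f` for the contraction action. -/
def contractAnn (f : MvPolynomial σ k) : Ideal (MvPolynomial σ k) where
  carrier := {g | contract g f = 0}
  zero_mem' := by simp
  add_mem' := by
    intro a b ha hb
    change contract (a + b) f = 0
    change contract a f = 0 at ha
    change contract b f = 0 at hb
    rw [map_add, LinearMap.add_apply, ha, hb, add_zero]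
  smul_mem' := by
    intro c x hx
    change contract (c • x) f = 0
    change contract x f = 0 at hx
    rw [smul_eq_mul, contract_mul, hx, map_zero]

theorem mem_contractAnn {f g : MvPolynomial σ k} : g ∈ contractAnn f ↔ contract g f = 0 := Iff.rfl

/-- The space `R ⌟ f` is finite dimensional. -/
theorem finite_range_contract (f : MvPolynomial σ k) :
    Module.Finite k (LinearMap.range (contract.flip f)) := by
  classical
  let s : Set (σ →₀ ℕ) := ⋃ α ∈ f.support, Set.Iic α
  have hs : s.Finite := f.support.finite_toSet.biUnion fun α _ => Set.finite_Iic α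
  have hle : LinearMap.range (contract.flip f) ≤
      Submodule.span k ((fun β => contract (monomial β (1 : k)) f) '' s) := by
    rintro _ ⟨g, rfl⟩
    rw [LinearMap.flip_apply]
    induction g using MvPolynomial.induction_on' with
    | add p q hp hq => rw [map_add]; exact add_mem hp hq
    | monomial β c =>
      by_cases hβ : β ∈ s
      · have : monomial β c = c • monomial β (1 : k) := by simp [smul_monomial]
        rw [this, map_smul]
        exact Submodule.smul_mem _ _ (Submodule.subset_span ⟨β, hβ, rfl⟩)
      · have : contract (monomial β c) f = 0 := by
          conv_lhs => rw [f.as_sum, map_sum]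
          refine Finset.sum_eq_zero fun α hα => ?_
          rw [contract_monomial, if_neg]
          intro h
          exact hβ (Set.mem_biUnion (Finset.mem_coe.2 hα) h)
        rw [this]
        exact zero_mem _
  have := FiniteDimensional.span_of_finite k (hs.image fun β => contract (monomial β (1 : k)) f)
  exact Submodule.finiteDimensional_of_le hle

end Contract

/-! ## Zero-dimensional subschemes of projective space -/

section Schemes

variable {k : Type*} [Field k] {n : ℕ}

/-- The subspace `I_i = I ∩ R_i` of `R_i`. -/
def gradedPiece (I : Ideal (MvPolynomial (Fin (n + 1)) k)) (i : ℕ) :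
    Submodule k (homogeneousSubmodule (Fin (n + 1)) k i) :=
  (I.restrictScalars k).comap (homogeneousSubmodule (Fin (n + 1)) k i).subtype

/-- The Hilbert function `i ↦ dim R_i / I_i`. -/
def hilbertFunction (I : Ideal (MvPolynomial (Fin (n + 1)) k)) (i : ℕ) : ℕ :=
  Module.finrank k (homogeneousSubmodule (Fin (n + 1)) k i ⧸ gradedPiece I i)

instance finite_homogeneousSubmodule (i : ℕ) :
    Module.Finite k (homogeneousSubmodule (Fin (n + 1)) k i) := by
  exact Module.Finite.iff_fg.2 (homogeneousSubmodule_fg _ _ i)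

theorem finrank_quotient_iInf_le {V : Type*} [AddCommGroup V] [Module k V] [Module.Finite k V]
    {s : ℕ} (W : Fin s → Submodule k V) :
    Module.finrank k (V ⧸ ⨅ i, W i) ≤ ∑ i, Module.finrank k (V ⧸ W i) := by
  let φ : V →ₗ[k] ((i : Fin s) → V ⧸ W i) := LinearMap.pi fun i => (W i).mkQ
  have h2 : LinearMap.ker φ = ⨅ i, W i := by
    rw [LinearMap.ker_pi]
    exact iInf_congr fun i => Submodule.ker_mkQ _
  rw [← h2, LinearEquiv.finrank_eq φ.quotKerEquivRange, ← Module.finrank_pi_fintype k]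
  exact Submodule.finrank_le _

theorem hilbertFunction_iInf_le {s : ℕ} (I : Fin s → Ideal (MvPolynomial (Fin (n + 1)) k))
    (e : ℕ) : hilbertFunction (⨅ i, I i) e ≤ ∑ i, hilbertFunction (I i) e := by
  have h : gradedPiece (⨅ i, I i) e = ⨅ i, gradedPiece (I i) e := by
    ext x
    simp [gradedPiece]
  unfold hilbertFunction
  rw [h]
  exact finrank_quotient_iInf_le _

/-- A closed subscheme `Z` of dimension at most `0` of `ℙⁿ`, given by its ideal `I(Z)` in
`R = k[Y_0, …, Y_n]`: closed subschemes correspond to homogeneous ideals that are saturated with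
respect to the irrelevant ideal, and the dimension is at most `0` exactly when the Hilbert function
is bounded. -/
structure ZeroDimScheme (k : Type*) [Field k] (n : ℕ) where
  /-- The ideal `I(Z)`. -/
  ideal : Ideal (MvPolynomial (Fin (n + 1)) k)
  homogeneous : ideal.IsHomogeneous (homogeneousSubmodule (Fin (n + 1)) k)
  saturated : ∀ p : MvPolynomial (Fin (n + 1)) k,
    (∃ m : ℕ, ∀ q : MvPolynomial (Fin (n + 1)) k, q.IsHomogeneous m → q * p ∈ ideal) → p ∈ ideal
  zeroDim : ∃ N : ℕ, ∀ i : ℕ, hilbertFunction ideal i ≤ N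

namespace ZeroDimScheme

/-- `Z'` is a strict subscheme of `Z`. -/
def IsStrictSubscheme (Z' Z : ZeroDimScheme k n) : Prop := Z.ideal < Z'.ideal

/-- `Z` has length `l`: its Hilbert polynomial is the constant `l`. -/
def HasLength (Z : ZeroDimScheme k n) (l : ℕ) : Prop :=
  ∀ᶠ i in Filter.atTop, hilbertFunction Z.ideal i = l

/-- `reg(Z) = min {i : HF_Z(i) = HF_Z(i + 1) = len(Z)}`, with the value `⊤` for an empty set. -/
def regularity (Z : ZeroDimScheme k n) : ℕ∞ :=
  sInf ((fun i : ℕ => (i : ℕ∞)) '' {i : ℕ | Z.HasLength (hilbertFunction Z.ideal i) ∧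
    Z.HasLength (hilbertFunction Z.ideal (i + 1))})

/-- `Z` is `d`-regular. -/
def IsRegular (Z : ZeroDimScheme k n) (d : ℕ) : Prop := Z.regularity ≤ d

/-- `Z` is apolar to `F`: `I(Z) ⊆ Ann(F)`. -/
def IsApolar (Z : ZeroDimScheme k n) (F : MvPolynomial (Fin (n + 1)) k) : Prop :=
  (Z.ideal : Set (MvPolynomial (Fin (n + 1)) k)) ⊆ annSet F

/-- `Z` is irredundant to `F`: it is apolar to `F`, and no strict subscheme of it is. -/
def IsIrredundant (Z : ZeroDimScheme k n) (F : MvPolynomial (Fin (n + 1)) k) : Prop :=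
  Z.IsApolar F ∧ ¬ ∃ Z' : ZeroDimScheme k n, Z'.IsStrictSubscheme Z ∧ Z'.IsApolar F

/-- The union of finitely many schemes, defined by the intersection of the ideals. -/
def union {s : ℕ} (Z : Fin s → ZeroDimScheme k n) : ZeroDimScheme k n where
  ideal := ⨅ i, (Z i).ideal
  homogeneous := Ideal.IsHomogeneous.iInf fun i => (Z i).homogeneous
  saturated := by
    rintro p ⟨m, hm⟩
    refine (Ideal.mem_iInf).2 fun i => (Z i).saturated p ⟨m, fun q hq => ?_⟩
    exact (Ideal.mem_iInf).1 (hm q hq) i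
  zeroDim := by
    choose N hN using fun i => (Z i).zeroDim
    exact ⟨∑ i, N i, fun e => (hilbertFunction_iInf_le _ e).trans
      (Finset.sum_le_sum fun i _ => hN i e)⟩

end ZeroDimScheme

end Schemes

/-! ## Natural apolar schemes -/

section NaturalApolar

variable {k : Type*} [Field k] {n : ℕ}

/-- A basis `L_0, …, L_n` of the space `S_1` of linear forms. -/
abbrev LinearCoords (k : Type*) [Field k] (n : ℕ) : Type _ :=
  Module.Basis (Fin (n + 1)) k (homogeneousSubmodule (Fin (n + 1)) k 1)

/-- The variable `X_m` as an element of `S_1`. -/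
def linX (m : Fin (n + 1)) : homogeneousSubmodule (Fin (n + 1)) k 1 := ⟨X m, isHomogeneous_X k m⟩

/-- The change of coordinates `φ` of `S` with `φ(L_j) = X_j`. -/
def changeS (b : LinearCoords k n) :
    MvPolynomial (Fin (n + 1)) k →ₐ[k] MvPolynomial (Fin (n + 1)) k :=
  aeval fun m => ∑ j, b.repr (linX m) j • X j

/-- The dual change of coordinates `ψ⁻¹` of `R`, where `ψ(Y_j)` is the basis of `R_1` dual to
`L_0, …, L_n`; so `ψ⁻¹(Y_m) = ∑_j (Y_m ∘ L_j) Y_j`. -/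
def changeR (b : LinearCoords k n) :
    MvPolynomial (Fin (n + 1)) k →ₐ[k] MvPolynomial (Fin (n + 1)) k :=
  aeval fun m => ∑ j, coeff (Finsupp.single m 1) (b j : MvPolynomial (Fin (n + 1)) k) • X j

/-- Dehomogenization: `G ↦ G(1, y_1, …, y_n)`. Applied to a stored divided power polynomial it
sends `X_0^[a] X'^[α]` to `x^[α]`. -/
def dehomogenize : MvPolynomial (Fin (n + 1)) k →ₐ[k] MvPolynomial (Fin n) k :=
  aeval (Fin.cons 1 X)

/-- The local generator `f_L = (φ F)_dp(1, x_1, …, x_n)`, where `L = L_0`. -/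
def localGenerator (b : LinearCoords k n) (F : MvPolynomial (Fin (n + 1)) k) :
    MvPolynomial (Fin n) k :=
  dehomogenize (toDividedPowers (changeS b F))

/-- The projection `R → k[y_1, …, y_n]` to the affine chart around `[L]`, in the coordinates `b`. -/
def chart (b : LinearCoords k n) : MvPolynomial (Fin (n + 1)) k →ₐ[k] MvPolynomial (Fin n) k :=
  dehomogenize.comp (changeR b)

/-- The homogenization, brought back to the original coordinates, of an ideal `J` of the affine
chart: the ideal of `R` generated by the homogeneous `G` whose dehomogenization lies in `J`. -/
def homogenizeIdeal (b : LinearCoords k n) (J : Ideal (MvPolynomial (Fin n) k)) :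
    Ideal (MvPolynomial (Fin (n + 1)) k) :=
  ((J.comap (chart b)).homogeneousCore (homogeneousSubmodule (Fin (n + 1)) k)).toIdeal

theorem eq_sum_linX (p : homogeneousSubmodule (Fin (n + 1)) k 1) :
    p = ∑ m, coeff (Finsupp.single m 1) (p : MvPolynomial (Fin (n + 1)) k) • linX m := by
  classical
  have hlin : ∀ m β, coeff β ((linX m : homogeneousSubmodule (Fin (n + 1)) k 1) :
      MvPolynomial (Fin (n + 1)) k) = if Finsupp.single m 1 = β then 1 else 0 := fun m β =>
    coeff_X m β
  apply Subtype.ext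
  ext β
  rw [Submodule.coe_sum, coeff_sum]
  simp only [Submodule.coe_smul, coeff_smul, hlin, smul_eq_mul, mul_ite, mul_one, mul_zero]
  by_cases hβ : β.degree = 1
  · obtain ⟨m, rfl⟩ := (Finsupp.sum_eq_one_iff β).1 hβ
    simp [Finsupp.single_left_inj]
  · rw [IsHomogeneous.coeff_eq_zero p.2 hβ, Finset.sum_eq_zero]
    intro m _
    rw [if_neg]
    rintro rfl
    simp at hβ

/-- A linear form that dehomogenizes to `1`. -/
theorem exists_chart_eq_one (b : LinearCoords k n) :
    ∃ T : MvPolynomial (Fin (n + 1)) k, T.IsHomogeneous 1 ∧ chart b T = 1 := by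
  refine ⟨∑ m, b.repr (linX m) 0 • X m, ?_, ?_⟩
  · refine Submodule.sum_mem (homogeneousSubmodule (Fin (n + 1)) k 1) fun m _ => ?_
    exact Submodule.smul_mem _ _ (isHomogeneous_X k m)
  · have key : ∀ j, ∑ m, b.repr (linX m) 0 *
        coeff (Finsupp.single m 1) (b j : MvPolynomial (Fin (n + 1)) k) = if j = 0 then 1 else 0 := by
      intro j
      have h := congrArg (fun p => b.repr p 0) (eq_sum_linX (b j))
      simp only [Module.Basis.repr_self, map_sum, map_smul, Finsupp.coe_finsetSum,
        Finset.sum_apply, Finsupp.smul_apply, smul_eq_mul, Finsupp.single_apply] at h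
      rw [h]
      exact Finset.sum_congr rfl fun m _ => mul_comm _ _
    have hc : changeR b (∑ m, b.repr (linX m) 0 • X m) = X 0 := by
      simp only [changeR, map_sum, map_smul, aeval_X, Finset.smul_sum, smul_smul]
      rw [Finset.sum_comm]
      simp only [← Finset.sum_smul, key]
      simp
    rw [chart, AlgHom.comp_apply, hc]
    simp [dehomogenize]

theorem mem_homogenizeIdeal_of_isHomogeneous (b : LinearCoords k n)
    (J : Ideal (MvPolynomial (Fin n) k)) {G : MvPolynomial (Fin (n + 1)) k} {e : ℕ}
    (hG : G.IsHomogeneous e) : G ∈ homogenizeIdeal b J ↔ chart b G ∈ J :=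
  ⟨fun h => Ideal.toIdeal_homogeneousCore_le _ (J.comap (chart b)) h, fun h =>
    Ideal.mem_homogeneousCore_of_homogeneous_of_mem ⟨e, hG⟩ h⟩

/-- The natural apolar scheme `Z_{F,L}`, computed in coordinates `L_0 = L, L_1, …, L_n`. -/
def naturalApolar (b : LinearCoords k n) (F : MvPolynomial (Fin (n + 1)) k) :
    ZeroDimScheme k n where
  ideal := homogenizeIdeal b (contractAnn (localGenerator b F))
  homogeneous := HomogeneousIdeal.isHomogeneous _
  saturated := by
    rintro p ⟨m, hm⟩
    obtain ⟨T, hT, hT1⟩ := exists_chart_eq_one b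
    have hhom : (homogenizeIdeal b (contractAnn (localGenerator b F))).IsHomogeneous
        (homogeneousSubmodule (Fin (n + 1)) k) := HomogeneousIdeal.isHomogeneous _
    have hTm : (T ^ m).IsHomogeneous m := by simpa using hT.pow m
    have h := hm (T ^ m) hTm
    refine (hhom.mem_iff _).2 fun e => ?_
    have he := (hhom.mem_iff _).1 h (m + e)
    rw [DirectSum.coe_decompose_mul_add_of_left_mem _ hTm] at he
    have hpe : (DirectSum.decompose (homogeneousSubmodule (Fin (n + 1)) k) p e :
        MvPolynomial (Fin (n + 1)) k).IsHomogeneous e :=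
      (DirectSum.decompose (homogeneousSubmodule (Fin (n + 1)) k) p e).2
    rw [mem_homogenizeIdeal_of_isHomogeneous b _ (hTm.mul hpe)] at he
    rw [mem_homogenizeIdeal_of_isHomogeneous b _ hpe]
    simpa [hT1] using he
  zeroDim := by
    have := finite_range_contract (localGenerator b F)
    refine ⟨Module.finrank k (LinearMap.range (contract.flip (localGenerator b F))), fun e => ?_⟩
    let φ : homogeneousSubmodule (Fin (n + 1)) k e →ₗ[k] MvPolynomial (Fin n) k :=
      contract.flip (localGenerator b F) ∘ₗ (chart b).toLinearMap ∘ₗ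
        (homogeneousSubmodule (Fin (n + 1)) k e).subtype
    have hφ : LinearMap.ker φ =
        gradedPiece (homogenizeIdeal b (contractAnn (localGenerator b F))) e := by
      ext x
      exact (mem_homogenizeIdeal_of_isHomogeneous b
        (contractAnn (localGenerator b F)) x.2).symm
    unfold hilbertFunction
    rw [← hφ]
    refine (LinearEquiv.finrank_eq φ.quotKerEquivRange).trans_le ?_
    exact Submodule.finrank_mono (LinearMap.range_comp_le_range _ _)

/-- `Z` is the natural apolar scheme to `F` supported at `L`. The coordinates `b` that complete `L`
to a basis of `S_1` may be chosen arbitrarily. -/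
def IsNaturalApolar (Z : ZeroDimScheme k n) (F L : MvPolynomial (Fin (n + 1)) k) : Prop :=
  ∃ b : LinearCoords k n, (b 0 : MvPolynomial (Fin (n + 1)) k) = L ∧ Z = naturalApolar b F

end NaturalApolar

/-! ## Generalized additive decompositions -/

section GAD

variable {k : Type*} [Field k] {n : ℕ}

/-- A generalized additive decomposition `F = ∑ L_i^(d - k_i) G_i` of a form `F` of degree `d`. -/
structure GAD (F : MvPolynomial (Fin (n + 1)) k) (d s : ℕ) where
  /-- The linear forms `L_i`. -/
  L : Fin s → MvPolynomial (Fin (n + 1)) k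
  /-- The degrees `k_i`. -/
  deg : Fin s → ℕ
  /-- The forms `G_i`. -/
  G : Fin s → MvPolynomial (Fin (n + 1)) k
  L_isHomogeneous : ∀ i, (L i).IsHomogeneous 1
  L_ne_zero : ∀ i, L i ≠ 0
  not_proportional : ∀ i j, i ≠ j → LinearIndependent k ![L i, L j]
  deg_le : ∀ i, deg i ≤ d
  G_isHomogeneous : ∀ i, (G i).IsHomogeneous (deg i)
  not_dvd : ∀ i, ¬ L i ∣ G i
  eq_sum : F = ∑ i, L i ^ (d - deg i) * G i

/-- `Z` is the scheme evinced by the decomposition: the union of the natural apolar schemes to the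
summands `L_i^(d - k_i) G_i`, supported at the `L_i`. -/
def GAD.Evinces {F : MvPolynomial (Fin (n + 1)) k} {d s : ℕ} (D : GAD F d s)
    (Z : ZeroDimScheme k n) : Prop :=
  ∃ W : Fin s → ZeroDimScheme k n,
    (∀ i, IsNaturalApolar (W i) (D.L i ^ (d - D.deg i) * D.G i) (D.L i)) ∧
      Z = ZeroDimScheme.union W

end GAD

end Apolarity

end

/-!
In the affine chart at `[L_i]` the scheme is defined by `Ann(f_i)`, where the local generator
`f_i` of the `i`-th summand has degree at most `k_i`. The scheme is `d`-regular as soon as the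
forms of degree `d` surject onto `∏ i, k[y] / Ann(f_i)`. With `Ann(f_i)` replaced by a power
`𝔪^(q_i)`, surjectivity holds if `q_i ≤ d + 1` and `q_i + q_j ≤ d + 1` for `i ≠ j`: independence
of the `L_i` provides linear forms `T_i` with `T_i(L_j) = δ_ij`, and powers of `T_i` are units at
`[L_i]` and vanish to high order at the other points. Since `𝔪^(k_i + 1) ⊆ Ann(f_i)`, this
settles (a).

For (b), suppose that a nonzero functional vanishes on the image. By Macaulay duality it sends
`(g_i)` to `∑ i, ((u_i g_i) ⌟ f_i)(0)` for some `u_i`. As the fat points of multiplicities `k_i`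
still impose independent conditions, the functional is nonzero on some tuple with
`g_i ∈ 𝔪^(k_i)`, where it only sees `u_i(0)`; so `u_{i₀}(0) ≠ 0` and `f_{i₀} ≠ 0` for some `i₀`.
With `c = u_{i₀}(0)⁻¹`, replacing every `f_i` by `(1 - c u_i) ⌟ f_i` enlarges the ideal strictly,
and the smaller scheme is still apolar to `F` because the functional vanishes on forms of degree
`d`.
-/

namespace Apolarity

attribute [local instance] MvPolynomial.gradedAlgebra

section Contraction

variable {k : Type*} [Field k] {σ : Type*}

theorem coeff_contract_monomial (β γ : σ →₀ ℕ) (c : k) (f : MvPolynomial σ k) :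
    coeff γ (contract (monomial β c) f) = c * coeff (γ + β) f := by
  classical
  induction f using MvPolynomial.induction_on' with
  | add p q hp hq => rw [map_add, coeff_add, hp, hq, coeff_add, mul_add]
  | monomial α e =>
    rw [contract_monomial, coeff_monomial]
    by_cases h : β ≤ α
    · simp [if_pos h, coeff_monomial, tsub_eq_iff_eq_add_of_le h]
    · rw [if_neg h, if_neg, coeff_zero, mul_zero]
      rintro rfl
      exact h le_add_self

theorem coeff_contract (γ : σ →₀ ℕ) (g f : MvPolynomial σ k) :
    coeff γ (contract g f) = ∑ β ∈ g.support, coeff β g * coeff (γ + β) f := by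
  conv_lhs => rw [g.as_sum]
  simp only [map_sum, LinearMap.sum_apply, coeff_sum, coeff_contract_monomial]

theorem constantCoeff_contract (g f : MvPolynomial σ k) :
    constantCoeff (contract g f) = ∑ β ∈ g.support, coeff β g * coeff β f := by
  simp only [constantCoeff_eq, coeff_contract, zero_add]

theorem coeff_eq_constantCoeff_contract (γ : σ →₀ ℕ) (f : MvPolynomial σ k) :
    coeff γ f = constantCoeff (contract (monomial γ 1) f) := by
  rw [constantCoeff_eq, coeff_contract_monomial, zero_add, one_mul]

theorem contract_one (f : MvPolynomial σ k) : contract 1 f = f := by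
  ext γ
  rw [← C_1, C_apply, coeff_contract_monomial, add_zero, one_mul]

theorem contract_comm (g h f : MvPolynomial σ k) :
    contract g (contract h f) = contract h (contract g f) := by
  rw [← contract_mul, ← contract_mul, mul_comm]

theorem contract_C (g : MvPolynomial σ k) (c : k) : contract g (C c) = C (constantCoeff g * c) := by
  classical
  induction g using MvPolynomial.induction_on' with
  | add p q hp hq => rw [map_add, LinearMap.add_apply, hp, hq, map_add, add_mul, C_add]
  | monomial β e =>
    rw [C_apply, contract_monomial, constantCoeff_monomial, C_apply]
    by_cases h : β = 0 <;> simp [h]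

theorem coeff_contract_eq_zero {r : ℕ} {g f : MvPolynomial σ k} (hg : g ∈ idealOfVars σ k ^ r)
    {γ : σ →₀ ℕ} (h : f.totalDegree < γ.degree + r) : coeff γ (contract g f) = 0 := by
  rw [coeff_contract]
  refine Finset.sum_eq_zero fun β hβ => ?_
  have hr : r ≤ β.degree := (mem_pow_idealOfVars_iff r g).1 hg β hβ
  rw [coeff_eq_zero_of_totalDegree_lt (f := f), mul_zero]
  change _ < (γ + β).degree
  rw [map_add]
  lia

theorem contract_eq_zero_of_mem_pow {r : ℕ} {g f : MvPolynomial σ k}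
    (hg : g ∈ idealOfVars σ k ^ r) (hf : f.totalDegree < r) : contract g f = 0 :=
  ext _ _ fun _ => coeff_contract_eq_zero hg (by lia)

theorem contract_eq_C_of_mem_pow {r : ℕ} {g f : MvPolynomial σ k}
    (hg : g ∈ idealOfVars σ k ^ r) (hf : f.totalDegree ≤ r) :
    contract g f = C (constantCoeff (contract g f)) := by
  classical
  ext γ
  rw [coeff_C, constantCoeff_eq]
  split_ifs with hγ
  · rw [hγ]
  · refine coeff_contract_eq_zero hg ?_
    have : γ.degree ≠ 0 := fun h => hγ ((Finsupp.degree_eq_zero_iff γ).1 h).symm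
    lia

theorem pow_idealOfVars_le_contractAnn {m : ℕ} {f : MvPolynomial σ k} (hf : f.totalDegree < m) :
    idealOfVars σ k ^ m ≤ contractAnn f :=
  fun _ hg => contract_eq_zero_of_mem_pow hg hf

theorem exists_pow_idealOfVars_le_contractAnn (f : MvPolynomial σ k) :
    ∃ m, idealOfVars σ k ^ m ≤ contractAnn f :=
  ⟨_, pow_idealOfVars_le_contractAnn f.totalDegree.lt_succ_self⟩

theorem contractAnn_le_contractAnn_contract (v f : MvPolynomial σ k) :
    contractAnn f ≤ contractAnn (contract v f) := by
  intro g hg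
  rw [mem_contractAnn, contract_comm, mem_contractAnn.1 hg, map_zero]

theorem exists_contract_eq_one {f : MvPolynomial σ k} (hf : f ≠ 0) : ∃ g, contract g f = 1 := by
  obtain ⟨α, hα, hdeg⟩ :=
    f.support.exists_mem_eq_sup (support_nonempty.2 hf) fun α => α.degree
  have hmem : monomial α (coeff α f)⁻¹ ∈ idealOfVars σ k ^ α.degree :=
    monomial_mem_pow_idealOfVars_iff _ _ (inv_ne_zero (mem_support_iff.1 hα)) |>.2 le_rfl
  refine ⟨monomial α (coeff α f)⁻¹, ?_⟩
  rw [contract_eq_C_of_mem_pow hmem hdeg.le, constantCoeff_eq, coeff_contract_monomial, zero_add,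
    inv_mul_cancel₀ (mem_support_iff.1 hα), C_1]

theorem contractAnn_lt_contractAnn_contract {v f : MvPolynomial σ k} (hv : constantCoeff v = 0)
    (hf : f ≠ 0) : contractAnn f < contractAnn (contract v f) := by
  obtain ⟨g, hg⟩ := exists_contract_eq_one hf
  refine SetLike.lt_iff_le_and_exists.2 ⟨contractAnn_le_contractAnn_contract v f, g, ?_, ?_⟩
  · rw [mem_contractAnn, contract_comm, hg, ← C_1, contract_C, hv, zero_mul, C_0]
  · rw [mem_contractAnn, hg]
    exact one_ne_zero

theorem exists_eq_constantCoeff_contract (f : MvPolynomial σ k)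
    (φ : Module.Dual k (MvPolynomial σ k)) (hφ : ∀ g ∈ contractAnn f, φ g = 0) :
    ∃ u, ∀ g, φ g = constantCoeff (contract (u * g) f) := by
  let A := LinearMap.range (contract.flip f)
  let B : A →ₗ[k] MvPolynomial σ k →ₗ[k] k :=
    (contract.flip ∘ₗ A.subtype).compr₂ (lcoeff k 0)
  have hB (a : A) (g) : B a g = constantCoeff (contract g (a : MvPolynomial σ k)) := rfl
  have hBinj : Function.Injective B := by
    refine (injective_iff_map_eq_zero B).2 fun a ha => Subtype.ext (ext _ _ fun γ => ?_)
    rw [coeff_eq_constantCoeff_contract, ← hB, ha]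
    rfl
  have := finite_range_contract f
  obtain ⟨ψ, rfl⟩ : φ ∈ LinearMap.range (contract.flip f).dualMap := by
    rw [LinearMap.range_dualMap_eq_dualAnnihilator_ker]
    exact (Submodule.mem_dualAnnihilator φ).2 hφ
  obtain ⟨u, hu⟩ := LinearMap.flip_surjective_iff₁.2 hBinj (ψ ∘ₗ A.subtype)
  refine ⟨u, fun g => ?_⟩
  rw [contract_mul]
  exact (LinearMap.congr_fun hu ⟨contract g f, g, rfl⟩).symm

end Contraction

section LocalUnits

variable {R : Type*} [CommRing R] {σ : Type*}

theorem mem_idealOfVars_iff {p : MvPolynomial σ R} :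
    p ∈ idealOfVars σ R ↔ constantCoeff p = 0 := by
  rw [← pow_one (idealOfVars σ R), mem_pow_idealOfVars_iff', constantCoeff_eq]
  simp only [Nat.lt_one_iff, Finsupp.degree_eq_zero_iff, forall_eq]

theorem exists_mul_sub_mem {J : Ideal (MvPolynomial σ R)} {N : ℕ} (hJ : idealOfVars σ R ^ N ≤ J)
    {t : MvPolynomial σ R} (ht : IsUnit (constantCoeff t)) (g : MvPolynomial σ R) :
    ∃ v, t * v - g ∈ J := by
  set a := constantCoeff t
  have hnil : IsNilpotent (Ideal.Quotient.mk J (t - C a)) :=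
    ⟨N, by
      rw [← map_pow, Ideal.Quotient.eq_zero_iff_mem]
      exact hJ (Ideal.pow_mem_pow (mem_idealOfVars_iff.2 (by simp [a])) N)⟩
  have hunit : IsUnit (Ideal.Quotient.mk J t) := by
    have := hnil.isUnit_add_left_of_commute ((ht.map C).map (Ideal.Quotient.mk J)) (.all _ _)
    rwa [← map_add, add_sub_cancel] at this
  obtain ⟨w, hw⟩ := hunit.exists_right_inv
  obtain ⟨v, rfl⟩ := Ideal.Quotient.mk_surjective w
  refine ⟨v * g, ?_⟩
  rw [← Ideal.Quotient.eq, map_mul, map_mul, ← mul_assoc, hw, one_mul]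

end LocalUnits

section Differentiation

variable {k : Type*} [Field k] {σ : Type*} [Fintype σ]

theorem toDividedPowers_monomial (α : σ →₀ ℕ) (c : k) :
    toDividedPowers (monomial α c) = monomial α (((∏ i, (α i).factorial : ℕ) : k) * c) := by
  have hc : monomial α c = c • basisMonomials σ k α := by
    simp [coe_basisMonomials, smul_monomial]
  rw [hc, map_smul, toDividedPowers, Module.Basis.constr_basis, smul_monomial, smul_eq_mul,
    mul_comm]

theorem coeff_toDividedPowers (α : σ →₀ ℕ) (f : MvPolynomial σ k) :
    coeff α (toDividedPowers f) = ((∏ i, (α i).factorial : ℕ) : k) * coeff α f := by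
  classical
  induction f using MvPolynomial.induction_on' with
  | add p q hp hq => rw [map_add, coeff_add, hp, hq, coeff_add, mul_add]
  | monomial β c =>
    rw [toDividedPowers_monomial, coeff_monomial, coeff_monomial]
    split_ifs with h
    · rw [h]
    · rw [mul_zero]

theorem constantCoeff_toDividedPowers (f : MvPolynomial σ k) :
    constantCoeff (toDividedPowers f) = constantCoeff f := by
  simp [constantCoeff_eq, coeff_toDividedPowers]

theorem isHomogeneous_toDividedPowers {f : MvPolynomial σ k} {d : ℕ} (hf : f.IsHomogeneous d) :
    (toDividedPowers f).IsHomogeneous d := by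
  intro α hα
  refine hf fun h => hα ?_
  rw [coeff_toDividedPowers, h, mul_zero]

open Classical in
theorem diffAction_monomial (β α : σ →₀ ℕ) (c e : k) :
    diffAction (monomial β c) (monomial α e) =
      if β ≤ α then monomial (α - β) (((∏ i, (α i).descFactorial (β i) : ℕ) : k) * (c * e))
      else 0 := by
  have hβ : monomial β c = c • basisMonomials σ k β := by
    simp [coe_basisMonomials, smul_monomial]
  have hα : monomial α e = e • basisMonomials σ k α := by
    simp [coe_basisMonomials, smul_monomial]
  rw [hβ, hα, map_smul, map_smul, LinearMap.smul_apply, diffAction, Module.Basis.constr_basis,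
    Module.Basis.constr_basis]
  split_ifs
  · simp only [smul_monomial, smul_eq_mul]
    congr 1
    ring
  · simp

theorem toDividedPowers_diffAction (g f : MvPolynomial σ k) :
    toDividedPowers (diffAction g f) = contract g (toDividedPowers f) := by
  classical
  induction g using MvPolynomial.induction_on' with
  | add p q hp hq => simp only [map_add, LinearMap.add_apply, hp, hq]
  | monomial β c =>
    induction f using MvPolynomial.induction_on' with
    | add p q hp hq => simp only [map_add, hp, hq]
    | monomial α e =>
      rw [diffAction_monomial, toDividedPowers_monomial, contract_monomial]
      split_ifs with h
      · have hfac : (∏ i, ((α - β) i).factorial) * ∏ i, (α i).descFactorial (β i) =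
            ∏ i, (α i).factorial := by
          rw [← Finset.prod_mul_distrib]
          exact Finset.prod_congr rfl fun i _ => Nat.factorial_mul_descFactorial (h i)
        rw [toDividedPowers_monomial, ← hfac]
        congr 1
        push_cast
        ring
      · exact map_zero _

theorem diffAction_X (m : σ) (f : MvPolynomial σ k) : diffAction (X m) f = pderiv m f := by
  classical
  induction f using MvPolynomial.induction_on' with
  | add p q hp hq => simp only [map_add, hp, hq]
  | monomial α e =>
    rw [X, diffAction_monomial, pderiv_monomial]
    split_ifs with h
    · congr 1
      rw [one_mul, mul_comm, Finset.prod_eq_single m]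
      · simp
      · intro i _ hi
        simp [Ne.symm hi]
      · simp
    · have hm : α m = 0 := by
        rwa [Finsupp.single_le_iff, Nat.one_le_iff_ne_zero, not_ne_iff] at h
      simp [hm]

variable [CharZero k]

theorem cast_prod_factorial_ne_zero (α : σ →₀ ℕ) : ((∏ i, (α i).factorial : ℕ) : k) ≠ 0 :=
  Nat.cast_ne_zero.2 (Finset.prod_ne_zero_iff.2 fun _ _ => Nat.factorial_ne_zero _)

theorem toDividedPowers_injective :
    Function.Injective (toDividedPowers : MvPolynomial σ k →ₗ[k] MvPolynomial σ k) := by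
  intro f g hfg
  ext α
  have h := congrArg (coeff α) hfg
  rw [coeff_toDividedPowers, coeff_toDividedPowers] at h
  exact mul_left_cancel₀ (cast_prod_factorial_ne_zero α) h

theorem toDividedPowers_surjective :
    Function.Surjective (toDividedPowers : MvPolynomial σ k →ₗ[k] MvPolynomial σ k) := by
  intro f
  induction f using MvPolynomial.induction_on' with
  | add p q hp hq =>
    obtain ⟨p', rfl⟩ := hp
    obtain ⟨q', rfl⟩ := hq
    exact ⟨p' + q', map_add _ _ _⟩
  | monomial α c =>
    refine ⟨monomial α ((((∏ i, (α i).factorial : ℕ) : k))⁻¹ * c), ?_⟩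
    rw [toDividedPowers_monomial, mul_inv_cancel_left₀ (cast_prod_factorial_ne_zero α)]

theorem diffAction_mul (g h f : MvPolynomial σ k) :
    diffAction (g * h) f = diffAction g (diffAction h f) := by
  apply toDividedPowers_injective
  simp only [toDividedPowers_diffAction, contract_mul]

theorem diffAction_C (c : k) (f : MvPolynomial σ k) : diffAction (C c) f = c • f := by
  apply toDividedPowers_injective
  rw [toDividedPowers_diffAction, map_smul, ← mul_one (C c), ← smul_eq_C_mul, map_smul,
    LinearMap.smul_apply, contract_one]

end Differentiation

section Coordinates

variable {k : Type*} [Field k] {n : ℕ}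

theorem dehomogenize_monomial (α : Fin (n + 1) →₀ ℕ) (c : k) :
    dehomogenize (monomial α c) = monomial α.tail c := by
  rw [dehomogenize, aeval_monomial, Finsupp.prod_fintype _ _ (fun _ => pow_zero _),
    Fin.prod_univ_succ, monomial_eq, Finsupp.prod_fintype _ _ (fun _ => pow_zero _)]
  simp [Finsupp.tail_apply, algebraMap_eq]

theorem dehomogenize_surjective :
    Function.Surjective (dehomogenize : MvPolynomial (Fin (n + 1)) k →ₐ[k] _) := by
  intro p
  refine ⟨rename Fin.succ p, ?_⟩
  have hsucc : (Fin.cons 1 X : Fin (n + 1) → MvPolynomial (Fin n) k) ∘ Fin.succ = X := by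
    ext1 j
    simp
  rw [dehomogenize, aeval_rename, hsucc, aeval_X_left_apply]

theorem degree_eq_add_degree_tail (α : Fin (n + 1) →₀ ℕ) : α.degree = α 0 + α.tail.degree := by
  rw [Finsupp.degree_eq_sum, Finsupp.degree_eq_sum, Fin.sum_univ_succ]
  rfl

theorem eq_of_degree_eq_of_tail_eq {α β : Fin (n + 1) →₀ ℕ} (hdeg : α.degree = β.degree)
    (htail : α.tail = β.tail) : α = β := by
  rw [degree_eq_add_degree_tail, degree_eq_add_degree_tail β, htail, add_left_inj] at hdeg
  rw [← Finsupp.cons_tail α, ← Finsupp.cons_tail β, hdeg, htail]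

theorem degree_eq_of_mem_support {R σ : Type*} [CommSemiring R] {f : MvPolynomial σ R} {d : ℕ}
    (hf : f.IsHomogeneous d) {α : σ →₀ ℕ} (hα : α ∈ f.support) : α.degree = d :=
  not_imp_comm.1 hf.coeff_eq_zero (mem_support_iff.1 hα)

theorem coeff_tail_dehomogenize {d : ℕ} {f : MvPolynomial (Fin (n + 1)) k}
    (hf : f.IsHomogeneous d) {α : Fin (n + 1) →₀ ℕ} (hα : α.degree = d) :
    coeff α.tail (dehomogenize f) = coeff α f := by
  classical
  conv_lhs => rw [f.as_sum]
  conv_rhs => rw [f.as_sum]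
  simp only [map_sum, dehomogenize_monomial, coeff_sum, coeff_monomial]
  refine Finset.sum_congr rfl fun β hβ => if_congr ⟨fun h => ?_, fun h => h ▸ rfl⟩ rfl rfl
  refine eq_of_degree_eq_of_tail_eq ?_ h
  rw [hα, degree_eq_of_mem_support hf hβ]

theorem constantCoeff_contract_dehomogenize {d : ℕ} {g f : MvPolynomial (Fin (n + 1)) k}
    (hg : g.IsHomogeneous d) (hf : f.IsHomogeneous d) :
    constantCoeff (contract (dehomogenize g) (dehomogenize f)) = constantCoeff (contract g f) := by
  conv_lhs => rw [g.as_sum]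
  simp only [constantCoeff_contract g f, map_sum, LinearMap.sum_apply, dehomogenize_monomial,
    constantCoeff_eq, coeff_contract_monomial, zero_add]
  refine Finset.sum_congr rfl fun β hβ => ?_
  rw [coeff_tail_dehomogenize hf (degree_eq_of_mem_support hg hβ)]

theorem changeS_linear (b : LinearCoords k n) (p : homogeneousSubmodule (Fin (n + 1)) k 1) :
    changeS b (p : MvPolynomial (Fin (n + 1)) k) = ∑ j, b.repr p j • X j := by
  conv_lhs => rw [eq_sum_linX p]
  conv_rhs => rw [eq_sum_linX p]
  simp only [Submodule.coe_sum, Submodule.coe_smul, map_sum, map_smul, linX, changeS, aeval_X,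
    Finset.smul_sum, Finsupp.coe_finsetSum, Finset.sum_apply, Finsupp.smul_apply, smul_eq_mul,
    Finset.sum_smul, mul_smul]
  rw [Finset.sum_comm]

theorem changeS_basis (b : LinearCoords k n) (j : Fin (n + 1)) :
    changeS b (b j : MvPolynomial (Fin (n + 1)) k) = X j := by
  rw [changeS_linear]
  simp [Finsupp.single_apply]

theorem changeS_surjective (b : LinearCoords k n) : Function.Surjective (changeS b) := by
  have hinv : (changeS b).comp (aeval fun j => (b j : MvPolynomial (Fin (n + 1)) k)) =
      AlgHom.id k _ := by
    ext1 j
    simp [changeS_basis]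
  exact fun p => ⟨_, DFunLike.congr_fun hinv p⟩

theorem isHomogeneous_sum_smul_X {R σ ι : Type*} [CommSemiring R] [Fintype ι] (c : ι → R)
    (v : ι → σ) : (∑ j, c j • X (v j) : MvPolynomial σ R).IsHomogeneous 1 :=
  Submodule.sum_mem (homogeneousSubmodule σ R 1) fun j _ =>
    Submodule.smul_mem _ _ (isHomogeneous_X R (v j))

theorem isHomogeneous_changeR (b : LinearCoords k n) {g : MvPolynomial (Fin (n + 1)) k} {d : ℕ}
    (hg : g.IsHomogeneous d) : (changeR b g).IsHomogeneous d := by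
  rw [← one_mul d]
  exact hg.aeval _ fun m => isHomogeneous_sum_smul_X _ id

theorem isHomogeneous_changeS (b : LinearCoords k n) {f : MvPolynomial (Fin (n + 1)) k} {d : ℕ}
    (hf : f.IsHomogeneous d) : (changeS b f).IsHomogeneous d := by
  rw [← one_mul d]
  exact hf.aeval _ fun m => isHomogeneous_sum_smul_X _ id

theorem constantCoeff_changeS (b : LinearCoords k n) (f : MvPolynomial (Fin (n + 1)) k) :
    constantCoeff (changeS b f) = constantCoeff f := by
  induction f using MvPolynomial.induction_on with
  | C a => simp [changeS, algebraMap_eq]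
  | add p q hp hq => simp only [map_add, hp, hq]
  | mul_X p i _ => simp [changeS, constantCoeff_X]

theorem pderiv_aeval {R σ τ : Type*} [CommSemiring R] [Fintype τ] (a : τ → MvPolynomial σ R)
    (j : σ) (f : MvPolynomial τ R) :
    pderiv j (aeval a f) = ∑ i, aeval a (pderiv i f) * pderiv j (a i) := by
  classical
  induction f using MvPolynomial.induction_on with
  | C c => simp [algebraMap_eq]
  | add p q hp hq => simp only [map_add, hp, hq, add_mul, Finset.sum_add_distrib]
  | mul_X p l hp =>
    simp only [map_mul, Derivation.leibniz, smul_eq_mul, aeval_X, hp, pderiv_X, map_add, add_mul,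
      Finset.sum_add_distrib, Finset.mul_sum, mul_assoc]
    congr 1
    simp [Pi.single_apply]

theorem sum_coeff_mul_repr_linX (b : LinearCoords k n) (l m : Fin (n + 1)) :
    ∑ j, coeff (Finsupp.single m 1) (b j : MvPolynomial (Fin (n + 1)) k) * b.repr (linX l) j =
      if l = m then 1 else 0 := by
  classical
  have h := congrArg (fun p : homogeneousSubmodule (Fin (n + 1)) k 1 =>
    coeff (Finsupp.single m 1) (p : MvPolynomial (Fin (n + 1)) k)) (b.sum_repr (linX l))
  simp only [Submodule.coe_sum, Submodule.coe_smul, coeff_sum, coeff_smul, smul_eq_mul, linX,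
    coeff_X, Finsupp.single_left_inj one_ne_zero] at h
  simp only [mul_comm (coeff _ _)]
  exact h

theorem changeS_pderiv (b : LinearCoords k n) (m : Fin (n + 1)) (f : MvPolynomial (Fin (n + 1)) k) :
    changeS b (pderiv m f) = ∑ j, coeff (Finsupp.single m 1)
      (b j : MvPolynomial (Fin (n + 1)) k) • pderiv j (changeS b f) := by
  classical
  have hX (i j) : pderiv j (∑ l, b.repr (linX i) l • X l) = C (b.repr (linX i) j) := by
    simp [pderiv_X, Pi.single_apply, smul_eq_C_mul]
  simp only [changeS, pderiv_aeval, hX, Finset.smul_sum]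
  rw [Finset.sum_comm]
  simp only [← mul_smul_comm, ← Finset.mul_sum, smul_eq_C_mul, ← C_mul, ← map_sum,
    sum_coeff_mul_repr_linX]
  simp

theorem changeS_diffAction [CharZero k] (b : LinearCoords k n)
    (g f : MvPolynomial (Fin (n + 1)) k) :
    changeS b (diffAction g f) = diffAction (changeR b g) (changeS b f) := by
  induction g using MvPolynomial.induction_on generalizing f with
  | C a => simp [diffAction_C, changeR, algebraMap_eq]
  | add p q hp hq => simp only [map_add, LinearMap.add_apply, hp, hq]
  | mul_X p m hp =>
    rw [diffAction_mul, hp, map_mul, diffAction_mul, diffAction_X, changeS_pderiv]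
    simp only [changeR, aeval_X, map_sum, map_smul, LinearMap.sum_apply, LinearMap.smul_apply,
      diffAction_X]

theorem constantCoeff_contract_chart [CharZero k] (b : LinearCoords k n) {d : ℕ}
    {g f : MvPolynomial (Fin (n + 1)) k} (hg : g.IsHomogeneous d) (hf : f.IsHomogeneous d) :
    constantCoeff (contract (chart b g) (localGenerator b f)) =
      constantCoeff (contract g (toDividedPowers f)) :=
  calc constantCoeff (contract (chart b g) (localGenerator b f))
      = constantCoeff (contract (changeR b g) (toDividedPowers (changeS b f))) :=
        constantCoeff_contract_dehomogenize (isHomogeneous_changeR b hg)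
          (isHomogeneous_toDividedPowers (isHomogeneous_changeS b hf))
    _ = constantCoeff (changeS b (diffAction g f)) := by
        rw [← toDividedPowers_diffAction, constantCoeff_toDividedPowers, changeS_diffAction]
    _ = constantCoeff (contract g (toDividedPowers f)) := by
        rw [constantCoeff_changeS, ← toDividedPowers_diffAction, constantCoeff_toDividedPowers]

theorem localGenerator_surjective [CharZero k] (b : LinearCoords k n) :
    Function.Surjective (localGenerator b) :=
  (dehomogenize_surjective.comp toDividedPowers_surjective).comp (changeS_surjective b)

theorem totalDegree_dehomogenize_X_zero_pow_mul_le (a : ℕ) {m : ℕ}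
    {G : MvPolynomial (Fin (n + 1)) k} (hG : G.IsHomogeneous m) :
    (dehomogenize (toDividedPowers (X 0 ^ a * G))).totalDegree ≤ m := by
  rw [G.as_sum, Finset.mul_sum, map_sum, map_sum]
  refine totalDegree_finsetSum_le fun γ hγ => ?_
  have htail : (Finsupp.single 0 a + γ).tail = γ.tail := by
    ext i
    simp [Finsupp.tail_apply]
  rw [X_pow_eq_monomial, monomial_mul, toDividedPowers_monomial, dehomogenize_monomial, htail]
  refine (totalDegree_monomial_le _ _).trans ?_
  rw [← degree_eq_of_mem_support hG hγ, degree_eq_add_degree_tail]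
  exact Nat.le_add_left _ _

theorem totalDegree_localGenerator_le (b : LinearCoords k n) (a : ℕ) {m : ℕ}
    {G : MvPolynomial (Fin (n + 1)) k} (hG : G.IsHomogeneous m) :
    (localGenerator b ((b 0 : MvPolynomial (Fin (n + 1)) k) ^ a * G)).totalDegree ≤ m := by
  rw [localGenerator, map_mul, map_pow, changeS_basis]
  exact totalDegree_dehomogenize_X_zero_pow_mul_le a (isHomogeneous_changeS b hG)

/-- The linear form in the dual variables `Y_0, …, Y_n` that corresponds to a functional on the
space `S_1` of linear forms, under the identification of `R_1` with the dual of `S_1`. -/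
noncomputable def dualForm (φ : Module.Dual k (homogeneousSubmodule (Fin (n + 1)) k 1)) :
    MvPolynomial (Fin (n + 1)) k :=
  ∑ m, φ (linX m) • X m

theorem isHomogeneous_dualForm (φ : Module.Dual k (homogeneousSubmodule (Fin (n + 1)) k 1)) :
    (dualForm φ).IsHomogeneous 1 :=
  isHomogeneous_sum_smul_X _ id

theorem changeR_dualForm (b : LinearCoords k n)
    (φ : Module.Dual k (homogeneousSubmodule (Fin (n + 1)) k 1)) :
    changeR b (dualForm φ) = ∑ j, φ (b j) • X j := by
  have hφ (j) : φ (b j) = ∑ m, coeff (Finsupp.single m 1)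
      (b j : MvPolynomial (Fin (n + 1)) k) * φ (linX m) := by
    conv_lhs => rw [eq_sum_linX (b j)]
    simp only [map_sum, map_smul, smul_eq_mul]
  simp only [dualForm, changeR, map_sum, map_smul, aeval_X, Finset.smul_sum, smul_smul, hφ,
    Finset.sum_smul]
  rw [Finset.sum_comm]
  simp only [mul_comm]

theorem chart_dualForm (b : LinearCoords k n)
    (φ : Module.Dual k (homogeneousSubmodule (Fin (n + 1)) k 1)) :
    chart b (dualForm φ) = C (φ (b 0)) + ∑ j : Fin n, φ (b j.succ) • X j := by
  rw [chart, AlgHom.comp_apply, changeR_dualForm, Fin.sum_univ_succ]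
  simp [dehomogenize, smul_eq_C_mul]

theorem constantCoeff_chart_dualForm (b : LinearCoords k n)
    (φ : Module.Dual k (homogeneousSubmodule (Fin (n + 1)) k 1)) :
    constantCoeff (chart b (dualForm φ)) = φ (b 0) := by
  simp [chart_dualForm]

theorem chart_dualForm_coord_zero (b : LinearCoords k n) : chart b (dualForm (b.coord 0)) = 1 := by
  simp [chart_dualForm]

theorem chart_dualForm_coord_succ (b : LinearCoords k n) (j : Fin n) :
    chart b (dualForm (b.coord j.succ)) = X j := by
  simp [chart_dualForm, Finsupp.single_apply]

theorem exists_isHomogeneous_chart_eq_monomial (b : LinearCoords k n) {p : ℕ} {β : Fin n →₀ ℕ}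
    (hβ : β.degree ≤ p) (c : k) :
    ∃ H : MvPolynomial (Fin (n + 1)) k, H.IsHomogeneous p ∧ chart b H = monomial β c := by
  refine ⟨C c * (dualForm (b.coord 0) ^ (p - β.degree) *
    ∏ j, dualForm (b.coord (Fin.succ j)) ^ β j), ?_, ?_⟩
  · have hprod := IsHomogeneous.prod Finset.univ
      (fun j => dualForm (b.coord (Fin.succ j)) ^ β j) (fun j => 1 * β j)
      fun j _ => (isHomogeneous_dualForm _).pow (β j)
    simp only [one_mul, ← Finsupp.degree_eq_sum] at hprod
    have hpow := ((isHomogeneous_dualForm (b.coord 0)).pow (p - β.degree)).mul hprod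
    rw [one_mul, Nat.sub_add_cancel hβ] at hpow
    exact hpow.C_mul c
  · simp only [map_mul, map_pow, map_prod, chart_dualForm_coord_zero, chart_dualForm_coord_succ,
      one_pow, one_mul, algHom_C, algebraMap_eq]
    rw [monomial_eq, Finsupp.prod_fintype _ _ fun _ => pow_zero _]

theorem exists_isHomogeneous_chart_sub_mem (b : LinearCoords k n) (p : ℕ)
    (g : MvPolynomial (Fin n) k) :
    ∃ H : MvPolynomial (Fin (n + 1)) k, H.IsHomogeneous p ∧
      chart b H - g ∈ idealOfVars (Fin n) k ^ (p + 1) := by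
  classical
  induction g using MvPolynomial.induction_on' with
  | add g₁ g₂ h₁ h₂ =>
    obtain ⟨H₁, hH₁, h₁⟩ := h₁
    obtain ⟨H₂, hH₂, h₂⟩ := h₂
    refine ⟨H₁ + H₂, hH₁.add hH₂, ?_⟩
    rw [map_add, add_sub_add_comm]
    exact add_mem h₁ h₂
  | monomial β c =>
    by_cases hβ : β.degree ≤ p
    · obtain ⟨H, hH, hHβ⟩ := exists_isHomogeneous_chart_eq_monomial b hβ c
      exact ⟨H, hH, by rw [hHβ, sub_self]; exact zero_mem _⟩
    · refine ⟨0, isHomogeneous_zero _ _ _, ?_⟩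
      rw [map_zero, zero_sub, neg_mem_iff, mem_pow_idealOfVars_iff]
      intro γ hγ
      rw [Finset.mem_singleton.1 (support_monomial_subset hγ)]
      exact not_le.1 hβ

end Coordinates

section Restriction

theorem exists_dual_apply_eq {K V ι : Type*} [Field K] [AddCommGroup V] [Module K V] {v : ι → V}
    (hv : LinearIndependent K v) (c : ι → K) : ∃ φ : Module.Dual K V, ∀ i, φ (v i) = c i := by
  obtain ⟨r, hr⟩ := LinearMap.exists_leftInverse_of_injective _ (LinearMap.ker_eq_bot.2 hv)
  refine ⟨Finsupp.linearCombination K c ∘ₗ r, fun i => ?_⟩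
  have hri : r (v i) = Finsupp.single i 1 := by
    simpa using LinearMap.congr_fun hr (Finsupp.single i 1)
  simp [hri]

variable {k : Type*} [Field k] {n : ℕ} {ι : Type*}

/-- Restriction of the forms of degree `e` to a union of schemes, the `i`-th of which is defined by
the ideal `J i` in the affine chart with coordinates `b i`. -/
noncomputable def restriction (b : ι → LinearCoords k n) (J : ι → Ideal (MvPolynomial (Fin n) k))
    (e : ℕ) : homogeneousSubmodule (Fin (n + 1)) k e →ₗ[k] Π i, MvPolynomial (Fin n) k ⧸ J i :=
  LinearMap.pi fun i => (Ideal.Quotient.mkₐ k (J i)).toLinearMap ∘ₗ (chart (b i)).toLinearMap ∘ₗ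
    (homogeneousSubmodule (Fin (n + 1)) k e).subtype

variable {b : ι → LinearCoords k n} {J J' : ι → Ideal (MvPolynomial (Fin n) k)} {e : ℕ}

theorem restriction_apply (G : homogeneousSubmodule (Fin (n + 1)) k e) (i : ι) :
    restriction b J e G i = Ideal.Quotient.mk (J i) (chart (b i) G) := rfl

theorem restriction_surjective_iff : Function.Surjective (restriction b J e) ↔
    ∀ g : ι → MvPolynomial (Fin n) k, ∃ G : MvPolynomial (Fin (n + 1)) k,
      G.IsHomogeneous e ∧ ∀ i, chart (b i) G - g i ∈ J i := by
  constructor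
  · intro h g
    obtain ⟨G, hG⟩ := h fun i => Ideal.Quotient.mk (J i) (g i)
    exact ⟨G, G.2, fun i => Ideal.Quotient.eq.1 (congrFun hG i)⟩
  · intro h w
    choose g hg using fun i => Ideal.Quotient.mk_surjective (w i)
    obtain ⟨G, hG, hGg⟩ := h g
    refine ⟨⟨G, hG⟩, funext fun i => ?_⟩
    rw [restriction_apply, ← hg i]
    exact Ideal.Quotient.eq.2 (hGg i)

theorem restriction_surjective_of_le (hJ : J ≤ J') (h : Function.Surjective (restriction b J e)) :
    Function.Surjective (restriction b J' e) := by
  refine restriction_surjective_iff.2 fun g => ?_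
  obtain ⟨G, hG, hGg⟩ := restriction_surjective_iff.1 h g
  exact ⟨G, hG, fun i => hJ i (hGg i)⟩

theorem mem_iInf_homogenizeIdeal {G : MvPolynomial (Fin (n + 1)) k} (hG : G.IsHomogeneous e) :
    G ∈ ⨅ i, homogenizeIdeal (b i) (J i) ↔ ∀ i, chart (b i) G ∈ J i := by
  simp only [Ideal.mem_iInf, mem_homogenizeIdeal_of_isHomogeneous _ _ hG]

theorem ker_restriction :
    LinearMap.ker (restriction b J e) = gradedPiece (⨅ i, homogenizeIdeal (b i) (J i)) e := by
  ext G
  rw [LinearMap.mem_ker, funext_iff]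
  simp only [restriction_apply, Pi.zero_apply, Ideal.Quotient.eq_zero_iff_mem]
  exact (mem_iInf_homogenizeIdeal G.2).symm

theorem hilbertFunction_eq_finrank (h : Function.Surjective (restriction b J e)) :
    hilbertFunction (⨅ i, homogenizeIdeal (b i) (J i)) e =
      Module.finrank k (Π i, MvPolynomial (Fin n) k ⧸ J i) := by
  rw [hilbertFunction, ← ker_restriction]
  exact (LinearMap.quotKerEquivOfSurjective _ h).finrank_eq

theorem restriction_succ_surjective (hJ : ∀ i, ∃ N, idealOfVars (Fin n) k ^ N ≤ J i)
    {φ : Module.Dual k (homogeneousSubmodule (Fin (n + 1)) k 1)} (hφ : ∀ i, φ (b i 0) ≠ 0)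
    (h : Function.Surjective (restriction b J e)) :
    Function.Surjective (restriction b J (e + 1)) := by
  refine restriction_surjective_iff.2 fun g => ?_
  have hunit (i) : IsUnit (constantCoeff (chart (b i) (dualForm φ))) := by
    rw [constantCoeff_chart_dualForm]
    exact (hφ i).isUnit
  choose N hN using hJ
  choose v hv using fun i => exists_mul_sub_mem (hN i) (hunit i) (g i)
  obtain ⟨G, hG, hGv⟩ := restriction_surjective_iff.1 h v
  refine ⟨dualForm φ * G, add_comm 1 e ▸ (isHomogeneous_dualForm φ).mul hG, fun i => ?_⟩
  have hsum := add_mem ((J i).mul_mem_left (chart (b i) (dualForm φ)) (hGv i)) (hv i)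
  rwa [mul_sub, sub_add_sub_cancel, ← map_mul] at hsum

theorem isRegular_of_restriction_surjective {d : ℕ} {Z : ZeroDimScheme k n}
    (hZ : Z.ideal = ⨅ i, homogenizeIdeal (b i) (J i))
    (hJ : ∀ i, ∃ N, idealOfVars (Fin n) k ^ N ≤ J i)
    (hb : LinearIndependent k fun i => b i 0)
    (h : Function.Surjective (restriction b J d)) : Z.IsRegular d := by
  obtain ⟨φ, hφ⟩ := exists_dual_apply_eq hb 1
  have hφ₀ (i) : φ (b i 0) ≠ 0 := by simp [hφ]
  have hHF : ∀ e ≥ d, hilbertFunction Z.ideal e =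
      Module.finrank k (Π i, MvPolynomial (Fin n) k ⧸ J i) := by
    intro e he
    rw [hZ]
    exact hilbertFunction_eq_finrank
      (Nat.le_induction h (fun _ _ => restriction_succ_surjective hJ hφ₀) e he)
  have hlen : ∀ e ≥ d, Z.HasLength (hilbertFunction Z.ideal e) := by
    intro e he
    filter_upwards [Filter.eventually_ge_atTop d] with i hi
    rw [hHF i hi, hHF e he]
  exact sInf_le ⟨d, ⟨hlen d le_rfl, hlen (d + 1) d.le_succ⟩, rfl⟩

end Restriction

section FatPoints

variable {k : Type*} [Field k] {n : ℕ} {ι : Type*} {b : ι → LinearCoords k n}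

theorem exists_isHomogeneous_chart_mem_pow (hb : LinearIndependent k fun i => b i 0)
    {q : ι → ℕ} {e : ℕ} {i : ι} (hi : q i ≤ e + 1) (hq : ∀ j ≠ i, q i + q j ≤ e + 1)
    (g : MvPolynomial (Fin n) k) :
    ∃ G : MvPolynomial (Fin (n + 1)) k, G.IsHomogeneous e ∧
      chart (b i) G - g ∈ idealOfVars (Fin n) k ^ q i ∧
      ∀ j ≠ i, chart (b j) G ∈ idealOfVars (Fin n) k ^ q j := by
  classical
  obtain hi₀ | ⟨p, hp⟩ : q i = 0 ∨ ∃ p, q i = p + 1 := by cases q i <;> simp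
  · exact ⟨0, isHomogeneous_zero _ _ _, by simp [hi₀], fun j _ => by simp⟩
  obtain ⟨φ, hφ⟩ := exists_dual_apply_eq hb (Pi.single i 1)
  set T := dualForm φ
  have hunit : IsUnit (constantCoeff (chart (b i) (T ^ (e - p)))) := by
    rw [map_pow, map_pow, constantCoeff_chart_dualForm, hφ, Pi.single_eq_same, one_pow]
    exact isUnit_one
  obtain ⟨v, hv⟩ := exists_mul_sub_mem (le_refl (idealOfVars (Fin n) k ^ q i)) hunit g
  obtain ⟨H, hH, hHv⟩ := exists_isHomogeneous_chart_sub_mem (b i) p v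
  refine ⟨T ^ (e - p) * H, ?_, ?_, fun j hj => ?_⟩
  · have hmul := ((isHomogeneous_dualForm φ).pow (e - p)).mul hH
    rwa [one_mul, Nat.sub_add_cancel (by lia)] at hmul
  · rw [← hp] at hHv
    have hsum := add_mem (Ideal.mul_mem_left _ (chart (b i) (T ^ (e - p))) hHv) hv
    rwa [mul_sub, sub_add_sub_cancel, ← map_mul] at hsum
  · have hTj : chart (b j) T ∈ idealOfVars (Fin n) k := by
      rw [mem_idealOfVars_iff, constantCoeff_chart_dualForm, hφ, Pi.single_eq_of_ne hj]
    rw [map_mul, map_pow]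
    refine Ideal.mul_mem_right _ _ (Ideal.pow_le_pow_right ?_ (Ideal.pow_mem_pow hTj _))
    have := hq j hj
    lia

theorem restriction_pow_surjective [Finite ι] (hb : LinearIndependent k fun i => b i 0)
    {q : ι → ℕ} {e : ℕ} (hq₁ : ∀ i, q i ≤ e + 1) (hq₂ : ∀ i j, i ≠ j → q i + q j ≤ e + 1) :
    Function.Surjective (restriction b (fun i => idealOfVars (Fin n) k ^ q i) e) := by
  classical
  have := Fintype.ofFinite ι
  refine restriction_surjective_iff.2 fun g => ?_
  choose G hG hGi hGj using fun i =>
    exists_isHomogeneous_chart_mem_pow hb (hq₁ i) (fun j hj => hq₂ i j hj.symm) (g i)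
  refine ⟨∑ j, G j, IsHomogeneous.sum _ _ _ fun j _ => hG j, fun i => ?_⟩
  rw [map_sum, ← Finset.add_sum_erase _ _ (Finset.mem_univ i), add_sub_right_comm]
  exact add_mem (hGi i) (sum_mem fun j hj => hGj j i (Finset.ne_of_mem_erase hj).symm)

theorem exists_restriction_surjective [Finite ι] (hb : LinearIndependent k fun i => b i 0)
    {J : ι → Ideal (MvPolynomial (Fin n) k)} (hJ : ∀ i, ∃ N, idealOfVars (Fin n) k ^ N ≤ J i) :
    ∃ e, Function.Surjective (restriction b J e) := by
  have := Fintype.ofFinite ι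
  choose N hN using hJ
  have hle (i) : N i ≤ ∑ j, N j := Finset.single_le_sum_of_canonicallyOrdered (Finset.mem_univ i)
  refine ⟨2 * ∑ j, N j, restriction_surjective_of_le hN (restriction_pow_surjective hb ?_ ?_)⟩
  · intro i
    have := hle i
    lia
  · intro i j _
    have := hle i
    have := hle j
    lia

theorem iInf_homogenizeIdeal_lt [Finite ι] (hb : LinearIndependent k fun i => b i 0)
    {J J' : ι → Ideal (MvPolynomial (Fin n) k)} (hJ : ∀ i, ∃ N, idealOfVars (Fin n) k ^ N ≤ J i)
    (hlt : J < J') :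
    ⨅ i, homogenizeIdeal (b i) (J i) < ⨅ i, homogenizeIdeal (b i) (J' i) := by
  classical
  obtain ⟨hle, i₀, hlt₀⟩ := Pi.lt_def.1 hlt
  obtain ⟨g, hg', hg⟩ := SetLike.exists_of_lt hlt₀
  obtain ⟨e, he⟩ := exists_restriction_surjective hb hJ
  obtain ⟨G, hG, hGg⟩ := restriction_surjective_iff.1 he (Pi.single i₀ g)
  have hmono : ⨅ i, homogenizeIdeal (b i) (J i) ≤ ⨅ i, homogenizeIdeal (b i) (J' i) :=
    iInf_mono fun i => Ideal.homogeneousCore_mono _ (Ideal.comap_mono (hle i))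
  refine SetLike.lt_iff_le_and_exists.2 ⟨hmono, G, ?_, fun hGJ => hg ?_⟩
  · refine (mem_iInf_homogenizeIdeal hG).2 fun i => ?_
    have hsingle : Pi.single (M := fun _ => MvPolynomial (Fin n) k) i₀ g i ∈ J' i := by
      obtain rfl | hi := eq_or_ne i i₀
      · rwa [Pi.single_eq_same]
      · rw [Pi.single_eq_of_ne hi]
        exact zero_mem _
    exact ((J' i).sub_mem_iff_left hsingle).1 (hle i (hGg i))
  · have hGi₀ := hGg i₀
    rw [Pi.single_eq_same] at hGi₀
    exact ((J i₀).sub_mem_iff_right ((mem_iInf_homogenizeIdeal hG).1 hGJ i₀)).1 hGi₀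

end FatPoints

section Irredundance

theorem constantCoeff_contract_homogeneousComponent {k σ : Type*} [Field k] {d : ℕ}
    {f : MvPolynomial σ k} (hf : f.IsHomogeneous d) (g : MvPolynomial σ k) :
    constantCoeff (contract (homogeneousComponent d g) f) = constantCoeff (contract g f) := by
  induction g using MvPolynomial.induction_on' with
  | add p q hp hq => simp only [map_add, LinearMap.add_apply, hp, hq]
  | monomial β c =>
    by_cases hβ : β.degree = d
    · rw [homogeneousComponent_of_mem (isHomogeneous_monomial c hβ), if_pos rfl]
    · rw [homogeneousComponent_of_mem (isHomogeneous_monomial c rfl), if_neg (Ne.symm hβ),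
        map_zero, LinearMap.zero_apply, map_zero, constantCoeff_eq, coeff_contract_monomial,
        zero_add, hf.coeff_eq_zero hβ, mul_zero]

variable {k : Type*} [Field k] {n : ℕ}

theorem ZeroDimScheme.isApolar_of_constantCoeff_contract_eq_zero [CharZero k]
    {Z : ZeroDimScheme k n} {d : ℕ} {F : MvPolynomial (Fin (n + 1)) k} (hF : F.IsHomogeneous d)
    (h : ∀ G ∈ Z.ideal, G.IsHomogeneous d →
      constantCoeff (contract G (toDividedPowers F)) = 0) : Z.IsApolar F := by
  intro G hG
  refine toDividedPowers_injective (ext _ _ fun γ => ?_)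
  have hmem := homogeneousComponent_mem_of_mem Z.homogeneous
    (Z.ideal.mul_mem_left (monomial γ 1) hG) d
  rw [toDividedPowers_diffAction, coeff_eq_constantCoeff_contract, ← contract_mul,
    ← constantCoeff_contract_homogeneousComponent (isHomogeneous_toDividedPowers hF),
    h _ hmem (homogeneousComponent_isHomogeneous _ _), map_zero, coeff_zero]

theorem constantCoeff_contract_toDividedPowers_sum [CharZero k] {ι : Type*} [Fintype ι]
    (b : ι → LinearCoords k n) {d : ℕ} {P : ι → MvPolynomial (Fin (n + 1)) k}
    (hP : ∀ i, (P i).IsHomogeneous d) {G : MvPolynomial (Fin (n + 1)) k} (hG : G.IsHomogeneous d) :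
    constantCoeff (contract G (toDividedPowers (∑ i, P i))) =
      ∑ i, constantCoeff (contract (chart (b i) G) (localGenerator (b i) (P i))) := by
  simp only [map_sum, constantCoeff_contract_chart _ hG (hP _)]

variable {ι : Type*} [Fintype ι] {b : ι → LinearCoords k n} {f : ι → MvPolynomial (Fin n) k}
  {e : ℕ}

theorem exists_sum_constantCoeff_contract_eq_zero
    (h : ¬ Function.Surjective (restriction b (fun i => contractAnn (f i)) e)) :
    ∃ u : ι → MvPolynomial (Fin n) k,
      (∀ G : MvPolynomial (Fin (n + 1)) k, G.IsHomogeneous e →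
        ∑ i, constantCoeff (contract (u i * chart (b i) G) (f i)) = 0) ∧
      ∃ g : ι → MvPolynomial (Fin n) k, ∑ i, constantCoeff (contract (u i * g i) (f i)) ≠ 0 := by
  classical
  obtain ⟨ψ, hψ, hker⟩ := Submodule.exists_le_ker_of_lt_top _
    (lt_top_iff_ne_top.2 (mt LinearMap.range_eq_top.1 h))
  choose u hu using fun i => exists_eq_constantCoeff_contract (f i)
    (ψ ∘ₗ LinearMap.single k _ i ∘ₗ (Ideal.Quotient.mkₐ k (contractAnn (f i))).toLinearMap)
    fun g hg => by simp [Ideal.Quotient.eq_zero_iff_mem.2 hg]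
  have hsum (g : ι → MvPolynomial (Fin n) k) :
      ∑ i, constantCoeff (contract (u i * g i) (f i)) =
        ψ fun i => Ideal.Quotient.mk (contractAnn (f i)) (g i) := by
    simp only [← hu, LinearMap.comp_apply, ← map_sum]
    exact congrArg ψ (Finset.univ_sum_single _)
  refine ⟨u, fun G hG => ?_, ?_⟩
  · rw [hsum]
    exact hker ⟨⟨G, hG⟩, rfl⟩
  · obtain ⟨w, hw⟩ := DFunLike.ne_iff.1 hψ
    choose g hg using fun i => Ideal.Quotient.mk_surjective (w i)
    refine ⟨g, ?_⟩
    rw [hsum, funext hg]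
    exact hw

theorem exists_constantCoeff_ne_zero_of_not_surjective
    (hb : LinearIndependent k fun i => b i 0) {m : ι → ℕ} (hf : ∀ i, (f i).totalDegree ≤ m i)
    (hm₁ : ∀ i, m i ≤ e + 1) (hm₂ : ∀ i j, i ≠ j → m i + m j ≤ e + 1)
    (h : ¬ Function.Surjective (restriction b (fun i => contractAnn (f i)) e)) :
    ∃ u : ι → MvPolynomial (Fin n) k,
      (∀ G : MvPolynomial (Fin (n + 1)) k, G.IsHomogeneous e →
        ∑ i, constantCoeff (contract (u i * chart (b i) G) (f i)) = 0) ∧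
      ∃ i, f i ≠ 0 ∧ constantCoeff (u i) ≠ 0 := by
  obtain ⟨u, hu, g, hg⟩ := exists_sum_constantCoeff_contract_eq_zero h
  obtain ⟨G, hG, hGg⟩ := restriction_surjective_iff.1 (restriction_pow_surjective hb hm₁ hm₂) g
  have hsub : ∑ i, constantCoeff (contract (u i * (chart (b i) G - g i)) (f i)) ≠ 0 := by
    simpa [mul_sub, hu G hG] using hg
  obtain ⟨i, -, hi⟩ := Finset.exists_ne_zero_of_sum_ne_zero hsub
  rw [contract_mul, contract_eq_C_of_mem_pow (hGg i) (hf i), contract_C, constantCoeff_C] at hi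
  refine ⟨u, hu, i, fun hfi => hi ?_, left_ne_zero_of_mul hi⟩
  rw [hfi, map_zero, map_zero, mul_zero]

theorem ZeroDimScheme.exists_ideal_eq_iInf_contractAnn [CharZero k] {s : ℕ}
    (b : Fin s → LinearCoords k n) (f : Fin s → MvPolynomial (Fin n) k) :
    ∃ Z : ZeroDimScheme k n, Z.ideal = ⨅ i, homogenizeIdeal (b i) (contractAnn (f i)) := by
  choose P hP using fun i => localGenerator_surjective (b i) (f i)
  refine ⟨union fun i => naturalApolar (b i) (P i), ?_⟩
  simp only [union, naturalApolar, hP]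

theorem not_isIrredundant_of_constantCoeff_ne_zero [CharZero k] {s d : ℕ}
    {b : Fin s → LinearCoords k n} (hb : LinearIndependent k fun i => b i 0)
    {P : Fin s → MvPolynomial (Fin (n + 1)) k} (hP : ∀ i, (P i).IsHomogeneous d)
    {Z : ZeroDimScheme k n}
    (hZ : Z.ideal = ⨅ i, homogenizeIdeal (b i) (contractAnn (localGenerator (b i) (P i))))
    {u : Fin s → MvPolynomial (Fin n) k}
    (hu : ∀ G : MvPolynomial (Fin (n + 1)) k, G.IsHomogeneous d →
      ∑ i, constantCoeff (contract (u i * chart (b i) G) (localGenerator (b i) (P i))) = 0)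
    {i₀ : Fin s} (hP₀ : localGenerator (b i₀) (P i₀) ≠ 0) (hu₀ : constantCoeff (u i₀) ≠ 0) :
    ¬ Z.IsIrredundant (∑ i, P i) := by
  set f := fun i => localGenerator (b i) (P i)
  set c := (constantCoeff (u i₀))⁻¹ with hc
  set v := fun i => 1 - C c * u i with hv
  have hv₀ : constantCoeff (v i₀) = 0 := by simp [hv, hc, hu₀]
  have hlt : (fun i => contractAnn (f i)) < fun i => contractAnn (contract (v i) (f i)) :=
    Pi.lt_def.2 ⟨fun i => contractAnn_le_contractAnn_contract _ _, i₀,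
      contractAnn_lt_contractAnn_contract hv₀ hP₀⟩
  obtain ⟨Z', hZ'⟩ := ZeroDimScheme.exists_ideal_eq_iInf_contractAnn b fun i => contract (v i) (f i)
  refine fun hirr => hirr.2 ⟨Z', ?_, ?_⟩
  · rw [ZeroDimScheme.IsStrictSubscheme, hZ, hZ']
    exact iInf_homogenizeIdeal_lt hb
      (fun i => exists_pow_idealOfVars_le_contractAnn (f i)) hlt
  · refine ZeroDimScheme.isApolar_of_constantCoeff_contract_eq_zero
      (IsHomogeneous.sum _ _ _ fun i _ => hP i) fun G hG hGd => ?_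
    rw [hZ', mem_iInf_homogenizeIdeal hGd] at hG
    have hGf (i) : constantCoeff (contract (chart (b i) G) (f i)) =
        c * constantCoeff (contract (u i * chart (b i) G) (f i)) := by
      have h₀ : constantCoeff (contract (v i * chart (b i) G) (f i)) = 0 := by
        rw [contract_mul, contract_comm, mem_contractAnn.1 (hG i), map_zero]
      rw [hv, sub_mul, one_mul, mul_assoc, ← smul_eq_C_mul] at h₀
      simpa [sub_eq_zero] using h₀
    rw [constantCoeff_contract_toDividedPowers_sum b hP hGd, Finset.sum_congr rfl fun i _ => hGf i,
      ← Finset.mul_sum, hu G hGd, mul_zero]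

end Irredundance

section Decompositions

variable {k : Type*} [Field k] {n d s : ℕ} {F : MvPolynomial (Fin (n + 1)) k} {D : GAD F d s}

/-- The `i`-th summand `L_i^(d - k_i) G_i` of a generalized additive decomposition. -/
noncomputable def GAD.summand (D : GAD F d s) (i : Fin s) : MvPolynomial (Fin (n + 1)) k :=
  D.L i ^ (d - D.deg i) * D.G i

theorem GAD.isHomogeneous_summand (D : GAD F d s) (i : Fin s) :
    (D.summand i).IsHomogeneous d := by
  have h := ((D.L_isHomogeneous i).pow (d - D.deg i)).mul (D.G_isHomogeneous i)
  rwa [one_mul, Nat.sub_add_cancel (D.deg_le i)] at h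

theorem GAD.totalDegree_localGenerator_summand_le {b : LinearCoords k n} {i : Fin s}
    (hb : (b 0 : MvPolynomial (Fin (n + 1)) k) = D.L i) :
    (localGenerator b (D.summand i)).totalDegree ≤ D.deg i := by
  rw [GAD.summand, ← hb]
  exact totalDegree_localGenerator_le b _ (D.G_isHomogeneous i)

namespace GAD.Evinces

variable {Z : ZeroDimScheme k n}

theorem exists_coords (hZ : D.Evinces Z) (hL : LinearIndependent k D.L) :
    ∃ b : Fin s → LinearCoords k n, LinearIndependent k (fun i => b i 0) ∧
      (∀ i, (b i 0 : MvPolynomial (Fin (n + 1)) k) = D.L i) ∧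
      Z.ideal = ⨅ i, homogenizeIdeal (b i) (contractAnn (localGenerator (b i) (D.summand i))) := by
  obtain ⟨W, hW, rfl⟩ := hZ
  choose b hb hWb using hW
  refine ⟨b, .of_comp (homogeneousSubmodule (Fin (n + 1)) k 1).subtype ?_, hb, ?_⟩
  · simpa only [Function.comp_def, Submodule.subtype_apply, hb] using hL
  · simp only [ZeroDimScheme.union, hWb]
    rfl

theorem isRegular_of_add_lt (hZ : D.Evinces Z) (hL : LinearIndependent k D.L)
    (hdeg : ∀ i j, i ≠ j → D.deg i + D.deg j < d) : Z.IsRegular d := by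
  obtain ⟨b, hb, hbL, hZb⟩ := hZ.exists_coords hL
  refine isRegular_of_restriction_surjective hZb
    (fun i => exists_pow_idealOfVars_le_contractAnn _) hb
    (restriction_surjective_of_le (J := fun i => idealOfVars (Fin n) k ^ (D.deg i + 1)) ?_
      (restriction_pow_surjective hb ?_ ?_))
  · exact fun i => pow_idealOfVars_le_contractAnn
      (Nat.lt_succ_of_le (totalDegree_localGenerator_summand_le (hbL i)))
  · exact fun i => Nat.succ_le_succ (D.deg_le i)
  · intro i j hij
    have := hdeg i j hij
    lia

theorem isRegular_of_isIrredundant [CharZero k] (hZ : D.Evinces Z)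
    (hL : LinearIndependent k D.L) (hdeg : ∀ i j, i ≠ j → D.deg i + D.deg j ≤ d + 1)
    (hirr : Z.IsIrredundant F) : Z.IsRegular d := by
  obtain ⟨b, hb, hbL, hZb⟩ := hZ.exists_coords hL
  refine isRegular_of_restriction_surjective hZb
    (fun i => exists_pow_idealOfVars_le_contractAnn _) hb ?_
  by_contra hsurj
  obtain ⟨u, hu, i₀, hf₀, hu₀⟩ := exists_constantCoeff_ne_zero_of_not_surjective hb
    (fun i => totalDegree_localGenerator_summand_le (hbL i))
    (fun i => (D.deg_le i).trans d.le_succ) hdeg hsurj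
  rw [D.eq_sum] at hirr
  exact not_isIrredundant_of_constantCoeff_ne_zero hb D.isHomogeneous_summand hZb hu hf₀ hu₀ hirr

end GAD.Evinces

end Decompositions

end Apolarity

theorem mainTheorem4_general {k : Type*} [Field k] [CharZero k] {n d s : ℕ}
    {F : MvPolynomial (Fin (n + 1)) k} {D : Apolarity.GAD F d s} (hL : LinearIndependent k D.L)
    {Z : Apolarity.ZeroDimScheme k n} (hZ : D.Evinces Z)
    (h : (∀ i j : Fin s, i ≠ j → (D.deg i : ℤ) + D.deg j < d) ∨
      ((∀ i j : Fin s, i ≠ j → (D.deg i : ℤ) + D.deg j - 2 < d) ∧ Z.IsIrredundant F)) :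
    Z.IsRegular d := by
  obtain hdeg | ⟨hdeg, hirr⟩ := h
  · exact hZ.isRegular_of_add_lt hL fun i j hij => mod_cast hdeg i j hij
  · refine hZ.isRegular_of_isIrredundant hL (fun i j hij => ?_) hirr
    have := hdeg i j hij
    lia

theorem mainTheorem4 {k : Type*} [Field k] [IsAlgClosed k] [CharZero k] {n d s : ℕ} (hs : 1 < s)
    (F : MvPolynomial (Fin (n + 1)) k) (hF : F.IsHomogeneous d)
    (D : Apolarity.GAD F d s) (hL : LinearIndependent k D.L)
    (Z : Apolarity.ZeroDimScheme k n) (hZ : D.Evinces Z)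
    (h : (∀ i j : Fin s, i ≠ j → (D.deg i : ℤ) + D.deg j < d) ∨
      ((∀ i j : Fin s, i ≠ j → (D.deg i : ℤ) + D.deg j - 2 < d) ∧ Z.IsIrredundant F)) :
    Z.IsRegular d :=
  mainTheorem4_general hL hZ h
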